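/- Let $\mathbb N=\{1,2,3,\dots\}$, let $\mathcal P_0(\mathbb N)$ be the set of its finite subsets, and let $\mathbb P_{\mathbb N}$ be the group of permutations of $\mathbb N$ that move only finitely many points. A quasi-local algebra is a unital $C^*$-algebra $\mathfrak A$ with a $*$-automorphism $\theta$ satisfying $\theta^2=\mathrm{id}$ and with closed $*$-subalgebras $\mathfrak A(I)\subset\mathfrak A$, $I\in\mathcal P_0(\mathbb N)$, each containing the unit of $\mathfrak A$, such that $\bigcup_I\mathfrak A(I)$ is dense in $\mathfrak A$ and (i) $\mathfrak A(I)\subset\mathfrak A(J)$ whenever $I\subset J$; (ii) $\theta(\mathfrak A(I))=\mathfrak A(I)$ for every $I$; (iii) if $I\cap J=\emptyset$ and $x\in\mathfrak A(I)$, $y\in\mathfrak A(J)$ are homogeneous (each is even, $\theta(z)=z$, or odd, $\theta(z)=-z$), then $xy=yx$ if $x$ or $y$ is even, and $xy=-yx$ if both are odd. A local action of $\mathbb P_{\mathbb N}$ on $\mathfrak A$ is a group homomorphism $\alpha:\mathbb P_{\mathbb N}\to\mathrm{Aut}(\mathfrak A)$, $\sigma\mapsto\alpha_\sigma$, such that $\alpha_\sigma\circ\theta=\theta\circ\alpha_\sigma$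 and $\alpha_\sigma(\mathfrak A(I))=\mathfrak A(\sigma(I))$ for all $\sigma\in\mathbb P_{\mathbb N}$ and $I\in\mathcal P_0(\mathbb N)$, and such that $\alpha_\sigma(a)=a$ for every $a\in\mathfrak A(I)$ whenever $\sigma(i)=i$ for all $i\in I$. A state $\omega$ on $\mathfrak A$ is symmetric if $\omega\circ\alpha_\sigma=\omega$ for every $\sigma\in\mathbb P_{\mathbb N}$. For $n\ge 1$ let $\sigma_n\in\mathbb P_{\mathbb N}$ be given by $\sigma_n(k)=k+2^{n-1}$ for $1\le k\le 2^{n-1}$, $\sigma_n(k)=k-2^{n-1}$ for $2^{n-1}<k\le 2^n$, and $\sigma_n(k)=k$ for $k>2^n$. **Theorem.** Let $\alpha$ be a local action of $\mathbb P_{\mathbb N}$ on a quasi-local algebra $\mathfrak A$, and let $\omega$ be a symmetric state on $\mathfrak A$. The following conditions are equivalent: 1. $\omega$ is an extreme point of the convex set of symmetric states; 2. $\omega$ is strongly clustering, that is, $\lim_{n\to\infty}\omega(\alpha_{\sigma_n}(a)b)=\omega(a)\omega(b)$ for all $a,b\in\mathfrak A$; 3. $\omega(ab)=\omega(a)\omega(b)$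 for all finite $I,J\subset\mathbb N$ with $I\cap J=\emptyset$, all $a\in\mathfrak A(I)$ and all $b\in\mathfrak A(J)$. -/

import Mathlib

namespace QuasiLocal

/-- The group of finite permutations of `{1, 2, 3, …}`: the permutations that move only
finitely many points. -/
def FinPerm : Subgroup (Equiv.Perm ℕ+) where
  carrier := {σ | {k | σ k ≠ k}.Finite}
  one_mem' := by simp
  mul_mem' := by
    intro σ τ hσ hτ
    refine (Set.Finite.union hσ hτ).subset ?_
    intro k hk
    by_contra h
    simp only [Set.mem_union, Set.mem_ofPred_eq, not_or, not_not] at h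
    exact hk (by simp [h.1, h.2])
  inv_mem' := by
    intro σ hσ
    refine Set.Finite.subset hσ ?_
    intro k hk h
    exact hk (by rw [Equiv.Perm.inv_eq_iff_eq]; exact h.symm)

/-- The map exchanging the block `{1, …, m}` with the block `{m + 1, …, 2 m}` by a translation of
length `m`, and fixing every `k > 2 m`. -/
def blockSwapFun (m k : ℕ+) : ℕ+ :=
  if k ≤ m then k + m else if k ≤ 2 * m then k - m else k

theorem blockSwapFun_blockSwapFun (m k : ℕ+) : blockSwapFun m (blockSwapFun m k) = k := by
  have hm := m.pos
  have hk := k.pos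
  apply PNat.eq
  unfold blockSwapFun
  simp only [← PNat.coe_le_coe, apply_ite PNat.val, PNat.add_coe, PNat.sub_coe, PNat.mul_coe,
    ← PNat.coe_lt_coe, PNat.val_ofNat]
  split_ifs <;> omega

/-- `blockSwapFun m` as a permutation. -/
def blockSwap (m : ℕ+) : Equiv.Perm ℕ+ where
  toFun := blockSwapFun m
  invFun := blockSwapFun m
  left_inv := blockSwapFun_blockSwapFun m
  right_inv := blockSwapFun_blockSwapFun m

theorem blockSwap_mem (m : ℕ+) : blockSwap m ∈ FinPerm := by
  refine (Set.finite_Iic (2 * m)).subset ?_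
  intro k hk
  by_contra h
  apply hk
  have h1 : ¬ k ≤ 2 * m := h
  have h2 : ¬ k ≤ m := by
    intro h3
    apply h1
    rw [← PNat.coe_le_coe] at h3 ⊢
    rw [PNat.mul_coe, PNat.val_ofNat]
    omega
  change blockSwapFun m k = k
  simp [blockSwapFun, h1, h2]

/-- For `n ≥ 1`, the permutation `σ_n` exchanging `{1, …, 2 ^ (n - 1)}` with
`{2 ^ (n - 1) + 1, …, 2 ^ n}` (the index `n = 0` is only a harmless repetition of `n = 1`). -/
def sigma (n : ℕ) : FinPerm := ⟨blockSwap (2 ^ (n - 1)), blockSwap_mem _⟩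

variable (A : Type*) [CStarAlgebra A]

/-- A quasi-local structure over the finite subsets of `{1, 2, 3, …}` on the unital
`C*`-algebra `A`: a `ℤ/2`-grading, given by an involutive `*`-automorphism, and a net of unital
`C*`-subalgebras with dense union. -/
structure QuasiLocalAlgebra where
  /-- the grading automorphism `θ` -/
  grading : A ≃⋆ₐ[ℂ] A
  grading_grading : ∀ a, grading (grading a) = a
  /-- the local algebras -/
  loc : Finset ℕ+ → StarSubalgebra ℂ A
  isClosed_loc : ∀ I, IsClosed (loc I : Set A)
  dense_iUnion_loc : Dense (⋃ I, (loc I : Set A))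
  loc_mono : ∀ I J, I ⊆ J → loc I ≤ loc J
  grading_image_loc : ∀ I, grading '' (loc I : Set A) = loc I
  /-- homogeneous elements with disjoint localization commute if one of them is even -/
  commute_of_even : ∀ I J, Disjoint I J → ∀ x ∈ loc I, ∀ y ∈ loc J,
    (grading x = x ∨ grading x = -x) → (grading y = y ∨ grading y = -y) →
      (grading x = x ∨ grading y = y) → x * y = y * x
  /-- odd elements with disjoint localization anticommute -/
  anticommute_of_odd : ∀ I J, Disjoint I J → ∀ x ∈ loc I, ∀ y ∈ loc J,
    grading x = -x → grading y = -y → x * y = -(y * x)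

variable {A}

/-- A local action of the finite permutations on a quasi-local algebra. A permutation carries the
algebra of a region `I` onto the algebra of `σ(I)`, and acts trivially on the algebra of a region
each of whose points it fixes. -/
structure LocalAction (Q : QuasiLocalAlgebra A) where
  /-- the action by `*`-automorphisms (the product of automorphisms is their composition) -/
  toHom : FinPerm →* (A ≃⋆ₐ[ℂ] A)
  map_grading : ∀ σ a, toHom σ (Q.grading a) = Q.grading (toHom σ a)
  image_loc : ∀ (I : Finset ℕ+) (σ : FinPerm),
    toHom σ '' (Q.loc I : Set A) = Q.loc (I.map (σ : Equiv.Perm ℕ+).toEmbedding)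
  apply_eq_self : ∀ (I : Finset ℕ+) (σ : FinPerm),
    (∀ i ∈ I, (σ : Equiv.Perm ℕ+) i = i) → ∀ a ∈ Q.loc I, toHom σ a = a

section

open scoped ComplexOrder

variable (A) in
/-- The states of `A`: the positive functionals of value `1` at the unit. -/
def states : Set (A →L[ℂ] ℂ) :=
  {ω | (∀ a, 0 ≤ ω (star a * a)) ∧ ω 1 = 1}

end

/-- The symmetric (that is, invariant) states of a local action. -/
def symmetricStates {Q : QuasiLocalAlgebra A} (α : LocalAction Q) : Set (A →L[ℂ] ℂ) :=
  {ω | ω ∈ states A ∧ ∀ σ a, ω (α.toHom σ a) = ω a}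

/-- Strong clustering: `ω(α_{σ_n}(a) b) → ω(a) ω(b)` for all `a` and `b`. -/
def StronglyClustering {Q : QuasiLocalAlgebra A} (α : LocalAction Q) (ω : A →L[ℂ] ℂ) : Prop :=
  ∀ a b : A, Filter.Tendsto (fun n : ℕ => ω (α.toHom (sigma n) a * b)) Filter.atTop
    (nhds (ω a * ω b))

end QuasiLocal

namespace QuasiLocal

theorem exists_finPerm_extend (K : Finset ℕ+) (f : ℕ+ → ℕ+) (hf : Set.InjOn f K) :
    ∃ τ : FinPerm, ∀ k ∈ K, (τ : Equiv.Perm ℕ+) k = f k := by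
  classical
  set T : Finset ℕ+ := K ∪ K.image f with hT
  obtain ⟨g, hg⟩ := Set.MapsTo.exists_equiv_extend_of_card_eq (α := T) (t := T)
    (Fintype.card_coe T) (s := {x | (x : ℕ+) ∈ K}) (f := fun x => f x)
    (fun x hx => Finset.mem_union_right _ (Finset.mem_image_of_mem f hx))
    (fun x hx y hy h => Subtype.ext (hf hx hy h))
  refine ⟨⟨Equiv.Perm.ofSubtype g, ?_⟩, fun k hk => ?_⟩
  · refine T.finite_toSet.subset fun k hk => ?_
    by_contra h
    exact hk (Equiv.Perm.ofSubtype_apply_of_not_mem g h)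
  · have hkT : k ∈ T := Finset.mem_union_left _ hk
    exact (Equiv.Perm.ofSubtype_apply_of_mem g hkT).trans (hg ⟨k, hkT⟩ hk)

/-- A finite permutation fixing `I` pointwise and agreeing with a given injection on `J`. -/
theorem exists_finPerm_fixing {I J : Finset ℕ+} (hIJ : Disjoint I J) (g : ℕ+ → ℕ+)
    (hg : Set.InjOn g J) (hgI : ∀ j ∈ J, g j ∉ I) :
    ∃ τ : FinPerm, (∀ i ∈ I, (τ : Equiv.Perm ℕ+) i = i) ∧
      ∀ j ∈ J, (τ : Equiv.Perm ℕ+) j = g j := by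
  classical
  obtain ⟨τ, hτ⟩ := exists_finPerm_extend (I ∪ J) (fun k => if k ∈ I then k else g k) (by
    intro x hx y hy h
    have hx' : x ∈ I ∨ x ∈ J := by simpa using hx
    have hy' : y ∈ I ∨ y ∈ J := by simpa using hy
    by_cases hxI : x ∈ I <;> by_cases hyI : y ∈ I <;> simp only [hxI, hyI, if_true, if_false] at h
    · exact h
    · exact absurd (h ▸ hxI) (hgI y (hy'.resolve_left hyI))
    · exact absurd (h ▸ hyI) (hgI x (hx'.resolve_left hxI))
    · exact hg (hx'.resolve_left hxI) (hy'.resolve_left hyI) h)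
  refine ⟨τ, fun i hi => ?_, fun j hj => ?_⟩
  · rw [hτ i (Finset.mem_union_left _ hi), if_pos hi]
  · rw [hτ j (Finset.mem_union_right _ hj), if_neg (Finset.disjoint_right.1 hIJ hj)]

theorem exists_forall_mem_le (K : Finset ℕ+) : ∃ N : ℕ, ∀ k ∈ K, (k : ℕ) ≤ N :=
  ⟨K.sup (fun k => (k : ℕ)), fun _ hk => Finset.le_sup (f := fun k : ℕ+ => (k : ℕ)) hk⟩

/-- Infinitely many pairwise disjoint copies of `J`, all obtained by permutations fixing `I`. -/
theorem exists_finPerm_seq {I J : Finset ℕ+} (hIJ : Disjoint I J) :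
    ∃ τ : ℕ → FinPerm, (∀ k, ∀ i ∈ I, (τ k : Equiv.Perm ℕ+) i = i) ∧
      ∀ k l, k ≠ l → Disjoint (J.map (τ k : Equiv.Perm ℕ+).toEmbedding)
        (J.map (τ l : Equiv.Perm ℕ+).toEmbedding) := by
  classical
  obtain ⟨N, hN⟩ := exists_forall_mem_le (I ∪ J)
  have hτ : ∀ k : ℕ, ∃ τ : FinPerm, (∀ i ∈ I, (τ : Equiv.Perm ℕ+) i = i) ∧
      ∀ j ∈ J, (τ : Equiv.Perm ℕ+) j = ⟨(j : ℕ) + k * N, Nat.add_pos_left j.pos _⟩ := by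
    intro k
    refine exists_finPerm_fixing hIJ (fun j => ⟨(j : ℕ) + k * N, Nat.add_pos_left j.pos _⟩)
      (fun x _ y _ h => ?_) (fun j hj hI => ?_)
    · have h' : (x : ℕ) + k * N = y + k * N := congrArg PNat.val h
      exact PNat.eq (by omega)
    · rcases Nat.eq_zero_or_pos k with rfl | hk
      · refine Finset.disjoint_right.1 hIJ hj ?_
        have h0 : (⟨(j : ℕ) + 0 * N, Nat.add_pos_left j.pos _⟩ : ℕ+) = j := PNat.eq (by simp)
        exact h0 ▸ hI
      · have h1 := hN _ (Finset.mem_union_left J hI)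
        have h2 := Nat.le_mul_of_pos_left N hk
        have h3 := j.pos
        simp only [PNat.mk_coe] at h1
        omega
  choose τ h1 h2 using hτ
  refine ⟨τ, h1, fun k l hkl => ?_⟩
  have key : ∀ k l, k < l → ∀ x ∈ J, ∀ y ∈ J, (x : ℕ) + k * N ≠ y + l * N := by
    intro k l hkl x hx y hy h
    have h3 : (k + 1) * N ≤ l * N := Nat.mul_le_mul_right N hkl
    have h4 := hN x (Finset.mem_union_right _ hx)
    have h5 := y.pos
    rw [add_mul] at h3
    omega
  rw [Finset.disjoint_left]
  intro z hz hz'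
  rw [Finset.mem_map] at hz hz'
  obtain ⟨x, hx, rfl⟩ := hz
  obtain ⟨y, hy, hxy⟩ := hz'
  simp only [Equiv.coe_toEmbedding] at hxy
  rw [h2 l y hy, h2 k x hx] at hxy
  have h' : (y : ℕ) + l * N = x + k * N := congrArg PNat.val hxy
  rcases lt_or_gt_of_ne hkl with h | h
  · exact key k l h x hx y hy h'.symm
  · exact key l k h y hy x hx h'

theorem eventually_sigma_apply_notMem (K : Finset ℕ+) :
    ∀ᶠ n in Filter.atTop, ∀ k ∈ K, (sigma n : Equiv.Perm ℕ+) k ∉ K := by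
  obtain ⟨N, hN⟩ := exists_forall_mem_le K
  filter_upwards [Filter.eventually_ge_atTop (N + 1)] with n hn k hk hk'
  have hle : ∀ j ∈ K, (j : ℕ) ≤ 2 ^ (n - 1) := fun j hj =>
    (hN j hj).trans ((Nat.lt_two_pow_self).le.trans (Nat.pow_le_pow_right two_pos (by omega)))
  have h1 : k ≤ 2 ^ (n - 1) := by
    rw [← PNat.coe_le_coe, PNat.pow_coe]
    exact hle k hk
  have h2 : (sigma n : Equiv.Perm ℕ+) k = k + 2 ^ (n - 1) := by
    change blockSwapFun _ _ = _
    rw [blockSwapFun, if_pos h1]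
  have h3 := hle _ hk'
  rw [h2, PNat.add_coe, PNat.pow_coe, PNat.val_ofNat] at h3
  have := k.pos
  omega

section LocalAction

variable {A : Type*} [CStarAlgebra A] {Q : QuasiLocalAlgebra A}

theorem LocalAction.apply_mem (α : LocalAction Q) (σ : FinPerm) {I : Finset ℕ+} {a : A}
    (ha : a ∈ Q.loc I) : α.toHom σ a ∈ Q.loc (I.map (σ : Equiv.Perm ℕ+).toEmbedding) := by
  have : α.toHom σ a ∈ α.toHom σ '' (Q.loc I : Set A) := ⟨a, ha, rfl⟩
  rwa [α.image_loc] at this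

theorem LocalAction.apply_congr (α : LocalAction Q) {σ τ : FinPerm} {I : Finset ℕ+}
    (h : ∀ i ∈ I, (σ : Equiv.Perm ℕ+) i = (τ : Equiv.Perm ℕ+) i) {a : A} (ha : a ∈ Q.loc I) :
    α.toHom σ a = α.toHom τ a := by
  have h1 : α.toHom (τ⁻¹ * σ) a = a := by
    refine α.apply_eq_self I _ (fun i hi => ?_) a ha
    simp [h i hi]
  calc α.toHom σ a = α.toHom (τ * (τ⁻¹ * σ)) a := by rw [mul_inv_cancel_left]
    _ = α.toHom τ (α.toHom (τ⁻¹ * σ) a) := by rw [map_mul]; rfl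
    _ = α.toHom τ a := by rw [h1]

theorem QuasiLocalAlgebra.grading_mem (Q : QuasiLocalAlgebra A) {I : Finset ℕ+} {a : A}
    (ha : a ∈ Q.loc I) : Q.grading a ∈ Q.loc I := by
  have : Q.grading a ∈ Q.grading '' (Q.loc I : Set A) := ⟨a, ha, rfl⟩
  rwa [Q.grading_image_loc] at this

/-- Every local element is the sum of an even and an odd local element. -/
theorem QuasiLocalAlgebra.exists_even_add_odd (Q : QuasiLocalAlgebra A) {I : Finset ℕ+} {a : A}
    (ha : a ∈ Q.loc I) : ∃ x ∈ Q.loc I, ∃ y ∈ Q.loc I, Q.grading x = x ∧ Q.grading y = -y ∧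
      x + y = a := by
  refine ⟨(2⁻¹ : ℂ) • (a + Q.grading a), (Q.loc I).smul_mem (add_mem ha (Q.grading_mem ha)) _,
    (2⁻¹ : ℂ) • (a - Q.grading a), (Q.loc I).smul_mem (sub_mem ha (Q.grading_mem ha)) _,
    ?_, ?_, ?_⟩
  · rw [map_smul, map_add, Q.grading_grading, add_comm]
  · rw [map_smul, map_sub, Q.grading_grading, ← smul_neg, neg_sub]
  · rw [← smul_add, add_add_sub_cancel, ← two_smul ℂ a, smul_smul]
    norm_num

theorem QuasiLocalAlgebra.commute_of_grading_eq (Q : QuasiLocalAlgebra A) {I J : Finset ℕ+}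
    (hIJ : Disjoint I J) {a b : A} (ha : a ∈ Q.loc I) (hb : b ∈ Q.loc J)
    (heven : Q.grading b = b) : Commute a b := by
  obtain ⟨x, hx, y, hy, hx', hy', rfl⟩ := Q.exists_even_add_odd ha
  exact Commute.add_left
    (Q.commute_of_even I J hIJ x hx b hb (Or.inl hx') (Or.inl heven) (Or.inr heven))
    (Q.commute_of_even I J hIJ y hy b hb (Or.inr hy') (Or.inl heven) (Or.inr heven))

theorem QuasiLocalAlgebra.dense_local (Q : QuasiLocalAlgebra A) {p : A → Prop}
    (hp : IsClosed {a | p a}) (h : ∀ I, ∀ a ∈ Q.loc I, p a) (a : A) : p a := by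
  have : closure (⋃ I, (Q.loc I : Set A)) ⊆ {a | p a} :=
    closure_minimal (Set.iUnion_subset fun I a ha => h I a ha) hp
  exact this (Q.dense_iUnion_loc a)

/-- In a symmetric state, correlations with a far away copy of `b` do not depend on the copy. -/
theorem symmetric_apply_mul {α : LocalAction Q} {ω : A →L[ℂ] ℂ} (hω : ω ∈ symmetricStates α)
    {I J : Finset ℕ+} (hIJ : Disjoint I J) {a b : A} (ha : a ∈ Q.loc I) (hb : b ∈ Q.loc J)
    {σ : FinPerm} (hσ : ∀ j ∈ J, (σ : Equiv.Perm ℕ+) j ∉ I) :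
    ω (a * α.toHom σ b) = ω (a * b) := by
  obtain ⟨τ, hτI, hτJ⟩ := exists_finPerm_fixing hIJ (σ : Equiv.Perm ℕ+)
    ((σ : Equiv.Perm ℕ+).injective.injOn) hσ
  rw [← hω.2 τ (a * b), map_mul (α.toHom τ), α.apply_eq_self I τ hτI a ha,
    α.apply_congr (fun j hj => (hτJ j hj).symm) hb]

theorem symmetric_apply_mul_congr {α : LocalAction Q} {ω : A →L[ℂ] ℂ}
    (hω : ω ∈ symmetricStates α) {I J : Finset ℕ+} {a b : A} (ha : a ∈ Q.loc I)
    (hb : b ∈ Q.loc J) {σ τ : FinPerm} (hσ : ∀ j ∈ J, (σ : Equiv.Perm ℕ+) j ∉ I)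
    (hτ : ∀ j ∈ J, (τ : Equiv.Perm ℕ+) j ∉ I) :
    ω (a * α.toHom σ b) = ω (a * α.toHom τ b) := by
  have h1 : Disjoint I (J.map (τ : Equiv.Perm ℕ+).toEmbedding) := by
    rw [Finset.disjoint_right]
    intro x hx
    obtain ⟨j, hj, rfl⟩ := Finset.mem_map.1 hx
    exact hτ j hj
  have h2 : α.toHom σ b = α.toHom (σ * τ⁻¹) (α.toHom τ b) := by
    calc α.toHom σ b = α.toHom (σ * τ⁻¹ * τ) b := by rw [inv_mul_cancel_right]
      _ = _ := by rw [map_mul]; rfl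
  rw [h2]
  refine symmetric_apply_mul hω h1 ha (α.apply_mem τ hb) fun x hx => ?_
  obtain ⟨j, hj, rfl⟩ := Finset.mem_map.1 hx
  simpa using hσ j hj

theorem symmetric_mul_apply {α : LocalAction Q} {ω : A →L[ℂ] ℂ} (hω : ω ∈ symmetricStates α)
    {I J : Finset ℕ+} (hIJ : Disjoint I J) {a b : A} (ha : a ∈ Q.loc I) (hb : b ∈ Q.loc J)
    {σ : FinPerm} (hσ : ∀ i ∈ I, (σ : Equiv.Perm ℕ+) i ∉ J) :
    ω (α.toHom σ a * b) = ω (a * b) := by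
  obtain ⟨τ, hτJ, hτI⟩ := exists_finPerm_fixing hIJ.symm (σ : Equiv.Perm ℕ+)
    ((σ : Equiv.Perm ℕ+).injective.injOn) hσ
  rw [← hω.2 τ (a * b), map_mul (α.toHom τ), α.apply_eq_self J τ hτJ b hb,
    α.apply_congr (fun j hj => (hτI j hj).symm) ha]

theorem product_of_stronglyClustering {α : LocalAction Q} {ω : A →L[ℂ] ℂ}
    (hω : ω ∈ symmetricStates α) (h : StronglyClustering α ω) {I J : Finset ℕ+}
    (hIJ : Disjoint I J) {a b : A} (ha : a ∈ Q.loc I) (hb : b ∈ Q.loc J) :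
    ω (a * b) = ω a * ω b := by
  classical
  refine tendsto_nhds_unique (tendsto_const_nhds.congr' ?_) (h a b)
  filter_upwards [eventually_sigma_apply_notMem (I ∪ J)] with n hn
  exact (symmetric_mul_apply hω hIJ ha hb fun i hi hJ =>
    hn i (Finset.mem_union_left _ hi) (Finset.mem_union_right _ hJ)).symm

end LocalAction

section States

open scoped ComplexOrder InnerProductSpace

variable {A : Type*} [CStarAlgebra A]

theorem states_cauchySchwarz {ω : A →L[ℂ] ℂ} (hω : ω ∈ states A) (x y : A) :
    ‖ω (star x * y)‖ ^ 2 ≤ (ω (star x * x)).re * (ω (star y * y)).re := by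
  let _ := CStarAlgebra.spectralOrder A
  let _ := CStarAlgebra.spectralOrderedRing A
  let f : A →ₚ[ℂ] ℂ := PositiveLinearMap.mk₀ ω.toLinearMap (fun z hz => by
    obtain ⟨w, rfl⟩ := CStarAlgebra.nonneg_iff_eq_star_mul_self.1 hz
    exact hω.1 w)
  have h := inner_mul_inner_self_le (𝕜 := ℂ) (f.toPreGNS x) (f.toPreGNS y)
  rw [norm_inner_symm (f.toPreGNS y) (f.toPreGNS x), ← sq] at h
  exact h

theorem states_map_star {ω : A →L[ℂ] ℂ} (hω : ω ∈ states A) (x : A) :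
    ω (star x) = star (ω x) := by
  let _ := CStarAlgebra.spectralOrder A
  let _ := CStarAlgebra.spectralOrderedRing A
  let f : A →ₚ[ℂ] ℂ := PositiveLinearMap.mk₀ ω.toLinearMap (fun z hz => by
    obtain ⟨w, rfl⟩ := CStarAlgebra.nonneg_iff_eq_star_mul_self.1 hz
    exact hω.1 w)
  exact map_star f x

theorem states_conj_one_add_nonneg {ω : A →L[ℂ] ℂ} (hω : ω ∈ states A) (a : A) {b : A}
    (hb : IsSelfAdjoint b) (hb1 : ‖b‖ ≤ 1) : 0 ≤ ω (star a * (1 + b) * a) := by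
  let _ := CStarAlgebra.spectralOrder A
  let _ := CStarAlgebra.spectralOrderedRing A
  have h1 : 0 ≤ 1 + b := by
    have h2 := hb.neg_algebraMap_norm_le_self
    have h3 : algebraMap ℝ A ‖b‖ ≤ algebraMap ℝ A 1 := algebraMap_mono A hb1
    rw [map_one] at h3
    calc (0 : A) = 1 + -1 := by simp
      _ ≤ 1 + -algebraMap ℝ A ‖b‖ := by gcongr
      _ ≤ 1 + b := by gcongr
  obtain ⟨w, hw⟩ := CStarAlgebra.nonneg_iff_eq_star_mul_self.1 (star_left_conjugate_nonneg h1 a)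
  rw [hw]
  exact hω.1 w

/-- If the second moments of the partial sums of a sequence grow at most linearly, then a constant
correlation with the members of the sequence vanishes. -/
theorem states_eq_zero_of_sum_bound {ω : A →L[ℂ] ℂ} (hω : ω ∈ states A) (a : A) (x : ℕ → A)
    {z : ℂ} {C : ℝ} (hz : ∀ k, ω (a * x k) = z)
    (hC : ∀ n, (ω (star (∑ k ∈ Finset.range n, x k) * ∑ k ∈ Finset.range n, x k)).re ≤ n * C) :
    z = 0 := by
  by_contra hz0
  have hpos : 0 < ‖z‖ ^ 2 := by positivity
  set K := (ω (star (star a) * star a)).re with hK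
  have hK0 : 0 ≤ K := (Complex.nonneg_iff.1 (hω.1 (star a))).1
  obtain ⟨n, hn⟩ := exists_nat_gt (K * C / ‖z‖ ^ 2)
  rw [div_lt_iff₀ hpos] at hn
  have hm : K * C < ((n + 1 : ℕ) : ℝ) * ‖z‖ ^ 2 := by
    push_cast
    linarith
  have h1 := states_cauchySchwarz hω (star a) (∑ k ∈ Finset.range (n + 1), x k)
  have h2 : ω (star (star a) * ∑ k ∈ Finset.range (n + 1), x k) = (n + 1 : ℕ) * z := by
    rw [star_star, Finset.mul_sum, map_sum, Finset.sum_congr rfl fun k _ => hz k]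
    simp
  have h3 := mul_le_mul_of_nonneg_left (hC (n + 1)) hK0
  rw [h2, norm_mul, Complex.norm_natCast, mul_pow] at h1
  have h4 : (0 : ℝ) < ((n + 1 : ℕ) : ℝ) := by positivity
  have h5 := mul_lt_mul_of_pos_left hm h4
  nlinarith

theorem sum_star_mul_sum_of_pairwise (f : A →L[ℂ] ℂ) (x : ℕ → A) {c : ℂ}
    (hoff : ∀ j k, j ≠ k → f (star (x j) * x k) = 0) (hdiag : ∀ k, f (star (x k) * x k) = c)
    (n : ℕ) :
    f (star (∑ k ∈ Finset.range n, x k) * ∑ k ∈ Finset.range n, x k) = n * c := by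
  rw [star_sum, Finset.sum_mul_sum, map_sum]
  calc ∑ j ∈ Finset.range n, f (∑ k ∈ Finset.range n, star (x j) * x k)
      = ∑ j ∈ Finset.range n, c := Finset.sum_congr rfl fun j hj => by
        rw [map_sum, Finset.sum_eq_single_of_mem j hj fun k _ hk => hoff j k hk.symm, hdiag]
    _ = n * c := by simp

theorem re_star_sum_mul_sum_le_of_anticommute {ω : A →L[ℂ] ℂ} (hω : ω ∈ states A) (x : ℕ → A)
    {C : ℝ} (hoff : ∀ j k, j ≠ k → star (x j) * x k + x k * star (x j) = 0)
    (hdiag : ∀ k, (ω (star (x k) * x k + x k * star (x k))).re = C) (n : ℕ) :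
    (ω (star (∑ k ∈ Finset.range n, x k) * ∑ k ∈ Finset.range n, x k)).re ≤ n * C := by
  set S := ∑ k ∈ Finset.range n, x k with hS
  have h0 : 0 ≤ (ω (S * star S)).re := by
    have := (Complex.nonneg_iff.1 (hω.1 (star S))).1
    rwa [star_star] at this
  have h1 : star S * S + S * star S
      = ∑ k ∈ Finset.range n, (star (x k) * x k + x k * star (x k)) := by
    rw [hS, star_sum, Finset.sum_mul_sum, Finset.sum_mul_sum,
      Finset.sum_comm (f := fun i j => x i * star (x j)),
      ← Finset.sum_add_distrib]
    refine Finset.sum_congr rfl fun j hj => ?_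
    rw [← Finset.sum_add_distrib]
    exact Finset.sum_eq_single_of_mem j hj fun k _ hk => hoff j k hk.symm
  have h2 : (ω (star S * S + S * star S)).re = n * C := by
    rw [h1, map_sum, Complex.re_sum, Finset.sum_congr rfl fun k _ => hdiag k]
    simp
  rw [map_add, Complex.add_re] at h2
  linarith

end States

section Density

variable {A : Type*} [CStarAlgebra A]

theorem isClosed_setOf_tendsto_of_lipschitz {E : Type*} [SeminormedAddCommGroup E]
    {D : ℕ → E → ℂ} {f : E → ℂ} {C : ℝ} (hD : ∀ n a b, ‖D n a - D n b‖ ≤ C * ‖a - b‖)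
    (hf : Continuous f) :
    IsClosed {a | Filter.Tendsto (fun n => D n a) Filter.atTop (nhds (f a))} := by
  refine isClosed_of_closure_subset fun a ha => ?_
  refine Metric.tendsto_atTop.2 fun ε hε => ?_
  have hC : 0 < |C| + 1 := by positivity
  have hnear : ∀ᶠ b in nhds a, dist (f b) (f a) < ε / 3 ∧ dist b a < ε / 3 / (|C| + 1) :=
    ((hf.tendsto a).eventually (Metric.ball_mem_nhds _ (by positivity))).and
      (Metric.ball_mem_nhds _ (by positivity))
  obtain ⟨b, ⟨hb1, hb2⟩, hb⟩ := mem_closure_iff_nhds.1 ha _ hnear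
  obtain ⟨N, hN⟩ := Metric.tendsto_atTop.1 hb (ε / 3) (by positivity)
  refine ⟨N, fun n hn => ?_⟩
  have h1 : dist (D n a) (D n b) < ε / 3 := by
    rw [dist_eq_norm]
    rw [lt_div_iff₀ hC, dist_comm, dist_eq_norm] at hb2
    have := hD n a b
    have h2 := mul_le_mul_of_nonneg_right (le_abs_self C) (norm_nonneg (a - b))
    nlinarith [norm_nonneg (a - b)]
  have h2 := dist_triangle4 (D n a) (D n b) (f b) (f a)
  have h3 := hN n hn
  linarith

variable {Q : QuasiLocalAlgebra A}

theorem LocalAction.norm_apply (α : LocalAction Q) (σ : FinPerm) (a : A) :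
    ‖α.toHom σ a‖ = ‖a‖ := StarAlgEquiv.norm_map (α.toHom σ) a

theorem LocalAction.continuous_apply (α : LocalAction Q) (σ : FinPerm) :
    Continuous (α.toHom σ) :=
  (AddMonoidHomClass.isometry_of_norm (α.toHom σ) (α.norm_apply σ)).continuous

theorem norm_apply_mul_mul_le (ω : A →L[ℂ] ℂ) (a b : A) : ‖ω (a * b)‖ ≤ ‖ω‖ * ‖a‖ * ‖b‖ := by
  rw [mul_assoc]
  exact (ω.le_opNorm _).trans
    (mul_le_mul_of_nonneg_left (norm_mul_le a b) (norm_nonneg _))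

theorem stronglyClustering_of_product {α : LocalAction Q} {ω : A →L[ℂ] ℂ}
    (hω : ω ∈ symmetricStates α)
    (h : ∀ I J : Finset ℕ+, Disjoint I J → ∀ a ∈ Q.loc I, ∀ b ∈ Q.loc J,
      ω (a * b) = ω a * ω b) : StronglyClustering α ω := by
  classical
  intro a b
  refine Q.dense_local (p := fun a => Filter.Tendsto (fun n => ω (α.toHom (sigma n) a * b))
    Filter.atTop (nhds (ω a * ω b))) ?_ (fun I a ha => ?_) a
  · refine isClosed_setOf_tendsto_of_lipschitz (C := ‖ω‖ * ‖b‖) (fun n x y => ?_) (by fun_prop)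
    rw [← map_sub, ← sub_mul, ← map_sub (α.toHom (sigma n))]
    refine (norm_apply_mul_mul_le ω _ b).trans_eq ?_
    rw [α.norm_apply, mul_right_comm]
  refine Q.dense_local (p := fun b => Filter.Tendsto (fun n => ω (α.toHom (sigma n) a * b))
    Filter.atTop (nhds (ω a * ω b))) ?_ (fun J b hb => ?_) b
  · refine isClosed_setOf_tendsto_of_lipschitz (C := ‖ω‖ * ‖a‖) (fun n x y => ?_) (by fun_prop)
    rw [← map_sub, ← mul_sub]
    refine (norm_apply_mul_mul_le ω _ _).trans_eq ?_
    rw [α.norm_apply]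
  refine tendsto_const_nhds.congr' ?_
  filter_upwards [eventually_sigma_apply_notMem (I ∪ J)] with n hn
  rw [h _ J ?_ _ (α.apply_mem _ ha) b hb, hω.2]
  rw [Finset.disjoint_left]
  intro x hx hxJ
  obtain ⟨i, hi, rfl⟩ := Finset.mem_map.1 hx
  exact hn i (Finset.mem_union_left _ hi) (Finset.mem_union_right _ hxJ)

/-- A limit point of the functionals `a ↦ ω (a α_{σ_n}(b))`. -/
theorem exists_limit_functional (α : LocalAction Q) (ω : A →L[ℂ] ℂ) (b : A) :
    ∃ φ : A →L[ℂ] ℂ, ∀ a z, (∀ᶠ n in Filter.atTop, ω (a * α.toHom (sigma n) b) = z) → φ a = z := by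
  have hex : ∀ a, ∃ z, ‖z‖ ≤ ‖ω‖ * ‖b‖ * ‖a‖ ∧
      Filter.Tendsto (fun n => ω (a * α.toHom (sigma n) b)) (Filter.hyperfilter ℕ) (nhds z) := by
    intro a
    obtain ⟨z, hz, hlim⟩ := (isCompact_closedBall (0 : ℂ) (‖ω‖ * ‖b‖ * ‖a‖)).ultrafilter_le_nhds
      ((Filter.hyperfilter ℕ).map fun n => ω (a * α.toHom (sigma n) b))
      (Filter.le_principal_iff.2 <| Filter.mem_map.2 <| Filter.univ_mem' fun n => by
        rw [Set.mem_preimage, mem_closedBall_zero_iff]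
        refine (norm_apply_mul_mul_le ω _ _).trans_eq ?_
        rw [α.norm_apply, mul_right_comm])
    exact ⟨z, mem_closedBall_zero_iff.1 hz, hlim⟩
  choose L hL1 hL2 using hex
  let Φ : A →ₗ[ℂ] ℂ :=
    { toFun := L
      map_add' := fun x y => tendsto_nhds_unique (hL2 (x + y)) (by
        simpa only [add_mul, map_add] using (hL2 x).add (hL2 y))
      map_smul' := fun c x => tendsto_nhds_unique (hL2 (c • x)) (by
        simpa only [smul_mul_assoc, map_smul, RingHom.id_apply] using (hL2 x).const_smul c) }
  refine ⟨Φ.mkContinuous _ hL1, fun a z h => ?_⟩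
  refine tendsto_nhds_unique (hL2 a) (tendsto_const_nhds.congr' ?_)
  have hle : (Filter.hyperfilter ℕ : Filter ℕ) ≤ Filter.atTop :=
    Nat.cofinite_eq_atTop ▸ Filter.hyperfilter_le_cofinite
  exact (h.filter_mono hle).mono fun n hn => hn.symm

end Density

open scoped ComplexOrder

variable {A : Type*} [CStarAlgebra A] {Q : QuasiLocalAlgebra A}

theorem symmetricStates_ext_local {ω ω' : A →L[ℂ] ℂ}
    (h : ∀ I, ∀ a ∈ Q.loc I, ω a = ω' a) : ω = ω' := by
  ext a
  exact Q.dense_local (isClosed_eq ω.continuous ω'.continuous) h a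

theorem LocalAction.grading_apply (α : LocalAction Q) (σ : FinPerm) (a : A) :
    Q.grading (α.toHom σ a) = α.toHom σ (Q.grading a) := (α.map_grading σ a).symm

/-- A symmetric state annihilates products with a differently localized odd element. -/
theorem symmetric_mul_odd {α : LocalAction Q} {ω : A →L[ℂ] ℂ} (hω : ω ∈ symmetricStates α)
    {I J : Finset ℕ+} (hIJ : Disjoint I J) {a b : A} (ha : a ∈ Q.loc I) (hb : b ∈ Q.loc J)
    (hodd : Q.grading b = -b) : ω (a * b) = 0 := by
  obtain ⟨τ, hτI, hτ⟩ := exists_finPerm_seq hIJ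
  refine states_eq_zero_of_sum_bound hω.1 a (fun k => α.toHom (τ k) b)
    (C := (ω (star b * b + b * star b)).re) (fun k => ?_)
    (re_star_sum_mul_sum_le_of_anticommute hω.1 _ (fun j k hjk => ?_) fun k => ?_)
  · rw [← hω.2 (τ k) (a * b), map_mul (α.toHom (τ k)), α.apply_eq_self I _ (hτI k) a ha]
  · have := Q.anticommute_of_odd _ _ (hτ j k hjk) _ (star_mem (α.apply_mem (τ j) hb)) _
      (α.apply_mem (τ k) hb) (by rw [map_star, α.grading_apply, hodd, map_neg, star_neg])
      (by rw [α.grading_apply, hodd, map_neg])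
    rw [this, neg_add_cancel]
  · rw [← map_star, ← map_mul (α.toHom (τ k)), ← map_mul (α.toHom (τ k)), ← map_add, hω.2]

theorem extreme_of_product {α : LocalAction Q} {ω : A →L[ℂ] ℂ} (hω : ω ∈ symmetricStates α)
    (h : ∀ I J : Finset ℕ+, Disjoint I J → ∀ a ∈ Q.loc I, ∀ b ∈ Q.loc J,
      ω (a * b) = ω a * ω b) : ω ∈ Set.extremePoints ℝ (symmetricStates α) := by
  refine ⟨hω, fun ω₁ h₁ ω₂ h₂ hseg => ?_⟩
  obtain ⟨s, t, hs, ht, hst, rfl⟩ := hseg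
  set ω := s • ω₁ + t • ω₂ with hωdef
  refine symmetricStates_ext_local (Q := Q) fun J a ha => ?_
  set x := a - ω a • (1 : A) with hx
  have hxJ : x ∈ Q.loc J := sub_mem ha ((Q.loc J).smul_mem (one_mem _) _)
  have hωx : ω x = 0 := by
    rw [hx, map_sub, map_smul, hω.1.2, smul_eq_mul, mul_one, sub_self]
  obtain ⟨τ, -, hτ⟩ := exists_finPerm_seq (Finset.disjoint_empty_left J)
  have hsum := sum_star_mul_sum_of_pairwise ω (fun k => α.toHom (τ k) x)
    (c := ω (star x * x))
    (fun j k hjk => by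
      rw [h _ _ (hτ j k hjk) _ (star_mem (α.apply_mem (τ j) hxJ)) _ (α.apply_mem (τ k) hxJ),
        hω.2, hωx, mul_zero])
    (fun k => by rw [← map_star, ← map_mul (α.toHom (τ k)), hω.2])
  have hzero : ω₁ x = 0 := by
    refine states_eq_zero_of_sum_bound h₁.1 1 (fun k => α.toHom (τ k) x)
      (C := (ω (star x * x)).re / s) (fun k => by rw [one_mul, h₁.2]) fun n => ?_
    have h3 := congrArg Complex.re (hsum n)
    set S := ∑ k ∈ Finset.range n, α.toHom (τ k) x
    have h4 : (ω (star S * S)).re = s * (ω₁ (star S * S)).re + t * (ω₂ (star S * S)).re := by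
      simp [hωdef]
    have h5 : 0 ≤ t * (ω₂ (star S * S)).re :=
      mul_nonneg ht.le (Complex.nonneg_iff.1 (h₂.1.1 S)).1
    have h6 : ((n : ℂ) * ω (star x * x)).re = n * (ω (star x * x)).re := by simp
    rw [← mul_div_assoc, le_div_iff₀ hs, ← h6, ← h3, h4]
    linarith
  rw [hx, map_sub, map_smul, h₁.1.2, smul_eq_mul, mul_one, sub_eq_zero] at hzero
  exact hzero

theorem symmetricStates_of_perturbation {α : LocalAction Q} {ω φ : A →L[ℂ] ℂ}
    (hω : ω ∈ symmetricStates α) {J : Finset ℕ+} {b : A} (hb : b ∈ Q.loc J)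
    (heven : Q.grading b = b) (hsa : IsSelfAdjoint b) (hb1 : ‖b‖ ≤ 1) (hωb : ω b = 0)
    (hφ : ∀ I, ∀ a ∈ Q.loc I, ∀ τ : FinPerm, (∀ j ∈ J, (τ : Equiv.Perm ℕ+) j ∉ I) →
      φ a = ω (a * α.toHom τ b)) : ω + φ ∈ symmetricStates α := by
  have hexists : ∀ I : Finset ℕ+, ∃ τ : FinPerm, ∀ j ∈ J, (τ : Equiv.Perm ℕ+) j ∉ I := by
    classical
    intro I
    obtain ⟨n, hn⟩ := (eventually_sigma_apply_notMem (I ∪ J)).exists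
    exact ⟨sigma n, fun j hj hI =>
      hn j (Finset.mem_union_right _ hj) (Finset.mem_union_left _ hI)⟩
  refine ⟨⟨fun a => ?_, ?_⟩, fun ρ a => ?_⟩
  · refine Q.dense_local (p := fun a => 0 ≤ (ω + φ) (star a * a))
      (isClosed_le continuous_const (by fun_prop)) (fun I a ha => ?_) a
    obtain ⟨τ, hτ⟩ := hexists I
    have hdisj : Disjoint I (J.map (τ : Equiv.Perm ℕ+).toEmbedding) := by
      rw [Finset.disjoint_right]
      intro x hx
      obtain ⟨j, hj, rfl⟩ := Finset.mem_map.1 hx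
      exact hτ j hj
    have hcomm : Commute a (α.toHom τ b) := Q.commute_of_grading_eq hdisj ha (α.apply_mem τ hb)
      (by rw [α.grading_apply, heven])
    have hrw : star a * a + star a * a * α.toHom τ b = star a * (1 + α.toHom τ b) * a := by
      rw [mul_add, mul_one, add_mul, mul_assoc, hcomm.eq, mul_assoc]
    rw [add_apply, hφ I _ (mul_mem (star_mem ha) ha) τ hτ, ← map_add, hrw]
    refine states_conj_one_add_nonneg hω.1 a ?_ ((α.norm_apply τ b).trans_le hb1)
    rw [IsSelfAdjoint, ← map_star, hsa.star_eq]
  · rw [add_apply, hω.1.2, hφ ∅ 1 (one_mem _) 1 (by simp), one_mul, hω.2,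
      hωb, add_zero]
  · rw [add_apply, add_apply, hω.2]
    congr 1
    refine Q.dense_local (p := fun a => φ (α.toHom ρ a) = φ a)
      (isClosed_eq (φ.continuous.comp (α.continuous_apply ρ)) φ.continuous) (fun I a ha => ?_) a
    obtain ⟨τ, hτ⟩ := hexists I
    rw [hφ I a ha τ hτ, hφ _ _ (α.apply_mem ρ ha) (ρ * τ) fun j hj hI => ?_]
    · rw [← hω.2 ρ (a * _), map_mul (α.toHom ρ), map_mul α.toHom]
      rfl
    · obtain ⟨i, hi, hij⟩ := Finset.mem_map.1 hI
      have : i = (τ : Equiv.Perm ℕ+) j := (ρ : Equiv.Perm ℕ+).injective hij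
      exact hτ j hj (this ▸ hi)

theorem extreme_mul_eq_zero_of_norm_le {α : LocalAction Q} {ω : A →L[ℂ] ℂ}
    (hω : ω ∈ Set.extremePoints ℝ (symmetricStates α)) {I J : Finset ℕ+} (hIJ : Disjoint I J)
    {a b : A} (ha : a ∈ Q.loc I) (hb : b ∈ Q.loc J) (heven : Q.grading b = b)
    (hsa : IsSelfAdjoint b) (hb1 : ‖b‖ ≤ 1) (hωb : ω b = 0) : ω (a * b) = 0 := by
  classical
  obtain ⟨φ, hφ⟩ := exists_limit_functional α ω b
  have hφ' : ∀ I, ∀ a ∈ Q.loc I, ∀ τ : FinPerm, (∀ j ∈ J, (τ : Equiv.Perm ℕ+) j ∉ I) →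
      φ a = ω (a * α.toHom τ b) := by
    intro I a ha τ hτ
    refine hφ a _ ?_
    filter_upwards [eventually_sigma_apply_notMem (I ∪ J)] with n hn
    exact symmetric_apply_mul_congr hω.1 ha hb (fun j hj hI =>
      hn j (Finset.mem_union_right _ hj) (Finset.mem_union_left _ hI)) hτ
  have h₁ : ω + φ ∈ symmetricStates α :=
    symmetricStates_of_perturbation hω.1 hb heven hsa hb1 hωb hφ'
  have h₂ : ω + -φ ∈ symmetricStates α :=
    symmetricStates_of_perturbation hω.1 (neg_mem hb) (by rw [map_neg, heven]) hsa.neg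
      (by rwa [norm_neg]) (by rw [map_neg, hωb, neg_zero]) fun I a ha τ hτ => by
        rw [neg_apply, hφ' I a ha τ hτ, map_neg, mul_neg, map_neg]
  have h₃ : ω + φ = ω := hω.2 h₁ h₂ ⟨1 / 2, 1 / 2, by norm_num, by norm_num, by norm_num, by
    ext x
    simp only [add_apply, smul_apply, neg_apply, Complex.real_smul]
    push_cast
    ring⟩
  have h₄ : φ a = 0 := by
    rw [add_eq_left.1 h₃, zero_apply]
  rw [← h₄, hφ' I a ha 1 fun j hj => Finset.disjoint_right.1 hIJ hj, map_one]
  rfl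

theorem extreme_mul_eq_zero_of_selfAdjoint {α : LocalAction Q} {ω : A →L[ℂ] ℂ}
    (hω : ω ∈ Set.extremePoints ℝ (symmetricStates α)) {I J : Finset ℕ+} (hIJ : Disjoint I J)
    {a b : A} (ha : a ∈ Q.loc I) (hb : b ∈ Q.loc J) (heven : Q.grading b = b)
    (hsa : IsSelfAdjoint b) (hωb : ω b = 0) : ω (a * b) = 0 := by
  have hpos : 0 < ‖b‖ + 1 := by positivity
  set r : ℂ := (((‖b‖ + 1)⁻¹ : ℝ) : ℂ) with hr
  have hr0 : r ≠ 0 := Complex.ofReal_ne_zero.2 (inv_ne_zero hpos.ne')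
  have h := extreme_mul_eq_zero_of_norm_le hω hIJ ha ((Q.loc J).smul_mem hb r)
    (by rw [map_smul, heven]) (IsSelfAdjoint.smul (by simp [IsSelfAdjoint, hr]) hsa)
    (by
      rw [norm_smul, hr, Complex.norm_real, Real.norm_of_nonneg (by positivity),
        inv_mul_le_iff₀ hpos]
      linarith)
    (by rw [map_smul, hωb, smul_zero])
  rw [mul_smul_comm, map_smul, smul_eq_mul] at h
  exact (mul_eq_zero.1 h).resolve_left hr0

theorem extreme_mul_eq_zero_of_even {α : LocalAction Q} {ω : A →L[ℂ] ℂ}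
    (hω : ω ∈ Set.extremePoints ℝ (symmetricStates α)) {I J : Finset ℕ+} (hIJ : Disjoint I J)
    {a b : A} (ha : a ∈ Q.loc I) (hb : b ∈ Q.loc J) (heven : Q.grading b = b)
    (hωb : ω b = 0) : ω (a * b) = 0 := by
  have hstar : ω (star b) = 0 := by rw [states_map_star hω.1.1, hωb, star_zero]
  have h₁ : ω (a * (b + star b)) = 0 := extreme_mul_eq_zero_of_selfAdjoint hω hIJ ha
    (add_mem hb (star_mem hb)) (by rw [map_add, map_star, heven])
    (IsSelfAdjoint.add_star_self b) (by rw [map_add, hωb, hstar, add_zero])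
  have h₂ : ω (a * (Complex.I • (b - star b))) = 0 := extreme_mul_eq_zero_of_selfAdjoint hω hIJ ha
    ((Q.loc J).smul_mem (sub_mem hb (star_mem hb)) _)
    (by rw [map_smul, map_sub, map_star, heven])
    (by
      rw [IsSelfAdjoint, star_smul, star_sub, star_star, Complex.star_def, Complex.conj_I,
        neg_smul, ← smul_neg, neg_sub])
    (by rw [map_smul, map_sub, hωb, hstar, sub_zero, smul_zero])
  rw [mul_smul_comm, map_smul, smul_eq_mul, mul_sub, map_sub] at h₂
  rw [mul_add, map_add] at h₁
  linear_combination (1 / 2 : ℂ) * h₁ + (1 / 2 : ℂ) *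
    (mul_eq_zero.1 h₂).resolve_left Complex.I_ne_zero

theorem product_of_extreme {α : LocalAction Q} {ω : A →L[ℂ] ℂ}
    (hω : ω ∈ Set.extremePoints ℝ (symmetricStates α)) {I J : Finset ℕ+} (hIJ : Disjoint I J)
    {a b : A} (ha : a ∈ Q.loc I) (hb : b ∈ Q.loc J) : ω (a * b) = ω a * ω b := by
  obtain ⟨x, hx, y, hy, hx', hy', rfl⟩ := Q.exists_even_add_odd hb
  have hy0 : ω y = 0 := by
    rw [← one_mul y]
    exact symmetric_mul_odd hω.1 (Finset.disjoint_empty_left J) (one_mem _) hy hy'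
  have hx0 := extreme_mul_eq_zero_of_even hω hIJ ha
    (sub_mem hx ((Q.loc J).smul_mem (one_mem _) (ω x)))
    (by rw [map_sub, map_smul, map_one, hx'])
    (by rw [map_sub, map_smul, hω.1.1.2, smul_eq_mul, mul_one, sub_self])
  rw [mul_sub, mul_smul_comm, mul_one, map_sub, map_smul, smul_eq_mul, sub_eq_zero] at hx0
  rw [mul_add, map_add, map_add, symmetric_mul_odd hω.1 hIJ ha hy hy', hy0, hx0, add_zero,
    add_zero, mul_comm]

end QuasiLocal

theorem mainTheorem3 {A : Type*} [CStarAlgebra A] (Q : QuasiLocal.QuasiLocalAlgebra A)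
    (α : QuasiLocal.LocalAction Q) (ω : A →L[ℂ] ℂ) (hω : ω ∈ QuasiLocal.symmetricStates α) :
    List.TFAE [
      ω ∈ Set.extremePoints ℝ (QuasiLocal.symmetricStates α),
      QuasiLocal.StronglyClustering α ω,
      ∀ I J : Finset ℕ+, Disjoint I J → ∀ a ∈ Q.loc I, ∀ b ∈ Q.loc J, ω (a * b) = ω a * ω b] := by
  tfae_have 1 → 3 := fun h _ _ hIJ _ ha _ hb => QuasiLocal.product_of_extreme h hIJ ha hb
  tfae_have 3 → 2 := QuasiLocal.stronglyClustering_of_product hω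
  tfae_have 2 → 3 := fun h _ _ hIJ _ ha _ hb =>
    QuasiLocal.product_of_stronglyClustering hω h hIJ ha hb
  tfae_have 3 → 1 := QuasiLocal.extreme_of_product hω
  tfae_finish
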